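/- Let $K$ be a field of characteristic zero, let $n\ge 1$, and let $K(\mathbf x)[\boldsymbol\partial]=K(x_1,\dots,x_n)[\partial_1,\dots,\partial_n]$ be the ring of linear partial differential operators with rational function coefficients ($\partial_i\partial_j=\partial_j\partial_i$ and $\partial_i f=f\partial_i+\partial f/\partial x_i$ for $f\in K(\mathbf x)$). Fix a graded monomial ordering $\prec$ on $\mathbb N^n$ (so $|\mathbf u|<|\mathbf v|$ implies $\mathbf u\prec\mathbf v$), and order the terms $\boldsymbol\partial^{\mathbf u}$ and the monomials $\mathbf x^{\mathbf u}$ accordingly. The head term of a nonzero operator is the highest term that appears in it, and its head coefficient is the coefficient of that term. Let $G$ be a primitive Gröbner basis in $K(\mathbf x)[\boldsymbol\partial]$. That is, $G$ is a finite set of nonzero operators such that: - the head term of every nonzero element of the left ideal $I=K(\mathbf x)[\boldsymbol\partial]\,G$ is divisible by the head term of an element of $G$; - $G$ is reduced: no term appearing in an element of $G$ is divisible by the head term of another element of $G$; - every element of $G$ has coefficients in $K[\mathbf x]$, and the greatest common divisor of these coefficients is $1$. Assume that $G$ has finite rank, that is, $\operatorname{rank}(G):=\dim_{K(\mathbf x)}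 K(\mathbf x)[\boldsymbol\partial]/I<\infty$. Let $\operatorname{PE}(G)$ be the set of all $\mathbf u\in\mathbb N^n$ such that $\boldsymbol\partial^{\mathbf u}$ is not divisible by the head term of any element of $G$. The initial exponent of a nonzero $f\in K[[\mathbf x]]$ is the $\prec$-least $\mathbf u$ such that $\mathbf x^{\mathbf u}$ has a nonzero coefficient in $f$. A formal power series solution of $G$ is an $f\in K[[\mathbf x]]$ with $g(f)=0$ for all $g\in G$. A point $\alpha\in\overline K^n$ is an ordinary point of $G$ if no head coefficient of an element of $G$ vanishes at $\alpha$. Then the origin is an ordinary point of $G$ if and only if $G$ has $\operatorname{rank}(G)$ many $K$-linearly independent formal power series solutions $f_1,\dots,f_{\operatorname{rank}(G)}\in K[[\mathbf x]]$ whose set of initial exponents is exactly $\operatorname{PE}(G)$. -/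

import Mathlib

noncomputable section

namespace DFinite

open scoped MonomialOrder

/-! ### Partial differential rings -/

/-- A commutative ring with `n` pairwise commuting derivations. -/
class PartialDifferential (n : ℕ) (A : Type*) [CommRing A] where
  /-- the `i`-th derivation -/
  der : Fin n → A →+ A
  der_mul : ∀ i a b, der i (a * b) = a * der i b + der i a * b
  der_comm : ∀ i j a, der i (der j a) = der j (der i a)

/-- The polynomial ring `K[x₁, …, xₙ]` with the usual partial derivatives. -/
instance instPolynomial (n : ℕ) (K : Type*) [CommRing K] :
    PartialDifferential n (MvPolynomial (Fin n) K) where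
  der i := (MvPolynomial.pderiv (R := K) i).toLinearMap.toAddMonoidHom
  der_mul i a b := by
    change MvPolynomial.pderiv i (a * b) =
      a * MvPolynomial.pderiv i b + MvPolynomial.pderiv i a * b
    rw [Derivation.leibniz, smul_eq_mul, smul_eq_mul, mul_comm b]
  der_comm i j a := by
    have h : ⁅MvPolynomial.pderiv (R := K) i, MvPolynomial.pderiv (R := K) j⁆ = 0 := by
      refine MvPolynomial.derivation_ext fun k => ?_
      simp [Derivation.commutator_apply, MvPolynomial.pderiv_X, Pi.single_apply, apply_ite]
    have h2 := DFunLike.congr_fun h a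
    rw [Derivation.commutator_apply] at h2
    exact sub_eq_zero.mp h2

theorem PartialDifferential.der_one {n : ℕ} {A : Type*} [CommRing A] [PartialDifferential n A]
    (i : Fin n) : der i (1 : A) = 0 := by
  have h := der_mul i (1 : A) 1
  simpa using h

section Fraction

variable {A : Type*} [CommRing A] [IsDomain A] {n : ℕ} [PartialDifferential n A]

open PartialDifferential

/-- The quotient rule: `∂ᵢ(a / b) = (∂ᵢ(a) b - a ∂ᵢ(b)) / b²`. -/
def fracDerFun (i : Fin n) (f : FractionRing A) : FractionRing A :=
  let s := IsLocalization.sec (nonZeroDivisors A) f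
  algebraMap A (FractionRing A) (der i s.1 * s.2 - s.1 * der i (s.2 : A)) /
    algebraMap A (FractionRing A) s.2 ^ 2

theorem fracDerFun_div (i : Fin n) (a b : A) (hb : b ≠ 0) :
    fracDerFun i (algebraMap A (FractionRing A) a / algebraMap A (FractionRing A) b) =
      algebraMap A (FractionRing A) (der i a * b - a * der i b) /
        algebraMap A (FractionRing A) b ^ 2 := by
  unfold fracDerFun
  have inj := IsFractionRing.injective A (FractionRing A)
  have hb' : algebraMap A (FractionRing A) b ≠ 0 := (map_ne_zero_iff _ inj).2 hb
  generalize hf : algebraMap A (FractionRing A) a / algebraMap A (FractionRing A) b = f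
  have hs := IsLocalization.sec_spec (nonZeroDivisors A) f
  generalize IsLocalization.sec (nonZeroDivisors A) f = s at hs ⊢
  obtain ⟨p, q, hq⟩ := s
  have hq0 : q ≠ 0 := nonZeroDivisors.ne_zero hq
  have hq' : algebraMap A (FractionRing A) q ≠ 0 := (map_ne_zero_iff _ inj).2 hq0
  simp only at hs ⊢
  have e : p * b = a * q := by
    apply inj
    rw [map_mul, map_mul, ← hs, ← hf]
    field_simp
  have e2 : p * der i b + der i p * b = a * der i q + der i a * q := by
    rw [← der_mul, ← der_mul, e]
  rw [div_eq_div_iff (pow_ne_zero _ hq') (pow_ne_zero _ hb')]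
  rw [← map_pow, ← map_pow, ← map_mul, ← map_mul]
  congr 1
  linear_combination (b * q) * e2 - (q * der i b + b * der i q) * e

/-- The extension of the `i`-th derivation of an integral domain to its field of fractions. -/
def fracDer (i : Fin n) : FractionRing A →+ FractionRing A :=
  AddMonoidHom.mk' (fracDerFun i) (by
    intro f g
    obtain ⟨a, b, hb, rfl⟩ := IsFractionRing.div_surjective (A := A) f
    obtain ⟨c, d, hd, rfl⟩ := IsFractionRing.div_surjective (A := A) g
    have inj := IsFractionRing.injective A (FractionRing A)
    have hb0 := nonZeroDivisors.ne_zero hb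
    have hd0 := nonZeroDivisors.ne_zero hd
    have hb' : algebraMap A (FractionRing A) b ≠ 0 := (map_ne_zero_iff _ inj).2 hb0
    have hd' : algebraMap A (FractionRing A) d ≠ 0 := (map_ne_zero_iff _ inj).2 hd0
    rw [div_add_div _ _ hb' hd', ← map_mul, ← map_mul, ← map_mul, ← map_add,
      fracDerFun_div _ _ _ (mul_ne_zero hb0 hd0), fracDerFun_div _ _ _ hb0,
      fracDerFun_div _ _ _ hd0]
    simp only [der_mul, map_add, map_sub, map_mul]
    field_simp
    ring)

theorem fracDer_div (i : Fin n) (a b : A) (hb : b ≠ 0) :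
    fracDer i (algebraMap A (FractionRing A) a / algebraMap A (FractionRing A) b) =
      algebraMap A (FractionRing A) (der i a * b - a * der i b) /
        algebraMap A (FractionRing A) b ^ 2 :=
  fracDerFun_div i a b hb

/-- The field of fractions of a partial differential domain. -/
instance instFractionRing : PartialDifferential n (FractionRing A) where
  der i := fracDer i
  der_mul i f g := by
    obtain ⟨a, b, hb, rfl⟩ := IsFractionRing.div_surjective (A := A) f
    obtain ⟨c, d, hd, rfl⟩ := IsFractionRing.div_surjective (A := A) g
    have inj := IsFractionRing.injective A (FractionRing A)
    have hb0 := nonZeroDivisors.ne_zero hb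
    have hd0 := nonZeroDivisors.ne_zero hd
    have hb' : algebraMap A (FractionRing A) b ≠ 0 := (map_ne_zero_iff _ inj).2 hb0
    have hd' : algebraMap A (FractionRing A) d ≠ 0 := (map_ne_zero_iff _ inj).2 hd0
    rw [div_mul_div_comm, ← map_mul, ← map_mul,
      fracDer_div _ _ _ (mul_ne_zero hb0 hd0), fracDer_div _ _ _ hb0, fracDer_div _ _ _ hd0]
    simp only [der_mul, map_add, map_sub, map_mul]
    field_simp
    ring
  der_comm i j f := by
    obtain ⟨a, b, hb, rfl⟩ := IsFractionRing.div_surjective (A := A) f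
    have inj := IsFractionRing.injective A (FractionRing A)
    have hb0 := nonZeroDivisors.ne_zero hb
    have hb' : algebraMap A (FractionRing A) b ≠ 0 := (map_ne_zero_iff _ inj).2 hb0
    rw [fracDer_div _ _ _ hb0, fracDer_div _ _ _ hb0, ← map_pow,
      fracDer_div _ _ _ (pow_ne_zero 2 hb0), fracDer_div _ _ _ (pow_ne_zero 2 hb0)]
    simp only [sq, der_mul, map_add, map_sub, map_mul, der_comm i j]
    ring

end Fraction

/-! ### Rings of differential operators -/

/-- `monomialPow T u = T₁^{u₁} T₂^{u₂} ⋯ Tₙ^{uₙ}`. -/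
def monomialPow {n : ℕ} {M : Type*} [Monoid M] (T : Fin n → M) (u : Fin n →₀ ℕ) : M :=
  ((List.finRange n).map fun i => T i ^ u i).prod

theorem monomialPow_zero {n : ℕ} {M : Type*} [Monoid M] (T : Fin n → M) :
    monomialPow T 0 = 1 := by
  simp [monomialPow]

theorem monomialPow_add {n : ℕ} {M : Type*} [Monoid M] (T : Fin n → M)
    (hT : ∀ i j, Commute (T i) (T j)) (u v : Fin n →₀ ℕ) :
    monomialPow T (u + v) = monomialPow T u * monomialPow T v := by
  unfold monomialPow
  induction List.finRange n with
  | nil => simp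
  | cons i l ih =>
    have hc : Commute (T i ^ v i) (l.map fun j => T j ^ u j).prod := by
      refine Commute.list_prod_right _ _ fun x hx => ?_
      obtain ⟨j, -, rfl⟩ := List.mem_map.1 hx
      exact (hT i j).pow_pow _ _
    simp only [List.map_cons, List.prod_cons, Finsupp.add_apply, pow_add]
    have ih' : (l.map fun j => T j ^ u j * T j ^ v j).prod =
        (l.map fun j => T j ^ u j).prod * (l.map fun j => T j ^ v j).prod := by
      simpa only [Finsupp.add_apply, pow_add] using ih
    rw [ih', mul_assoc, mul_assoc, ← mul_assoc (T i ^ v i), hc.eq, mul_assoc]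

theorem monomialPow_single {n : ℕ} {M : Type*} [Monoid M] (T : Fin n → M) (i : Fin n) :
    monomialPow T (Finsupp.single i 1) = T i := by
  unfold monomialPow
  rw [List.prod_map_eq_pow_single i]
  · simp [List.count_eq_one_of_mem (List.nodup_finRange n) (List.mem_finRange i)]
  · intro j hj _
    simp [hj.symm]

/-- The ring `A[∂₁, …, ∂ₙ]` of linear partial differential operators over a partial differential
ring `A`. An operator `∑ a_u ∂^u` is given by its coefficients `u ↦ a_u`. -/
def DiffOp (n : ℕ) (A : Type*) [CommRing A] : Type _ := (Fin n →₀ ℕ) →₀ A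

namespace DiffOp

variable {n : ℕ} {A : Type*} [CommRing A]

instance : AddCommGroup (DiffOp n A) :=
  inferInstanceAs (AddCommGroup ((Fin n →₀ ℕ) →₀ A))

/-- `A` acts by multiplication of all coefficients. -/
instance : Module A (DiffOp n A) :=
  inferInstanceAs (Module A ((Fin n →₀ ℕ) →₀ A))

/-- The operator `a ∂^u`. -/
def single (u : Fin n →₀ ℕ) (a : A) : DiffOp n A := Finsupp.single u a

/-- The coefficient of `∂^u` in `P`. -/
def coeff (u : Fin n →₀ ℕ) (P : DiffOp n A) : A := Finsupp.toFun P u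

/-- The exponents of the terms that appear in `P`. -/
def support (P : DiffOp n A) : Finset (Fin n →₀ ℕ) := Finsupp.support P

@[simp] theorem single_zero (u : Fin n →₀ ℕ) : single u (0 : A) = 0 := Finsupp.single_zero u

theorem single_add (u : Fin n →₀ ℕ) (a b : A) : single u (a + b) = single u a + single u b :=
  Finsupp.single_add u a b

theorem smul_single (a : A) (u : Fin n →₀ ℕ) (b : A) : a • single u b = single u (a * b) :=
  Finsupp.smul_single a u b

theorem addHom_ext {M : Type*} [AddMonoid M] {f g : DiffOp n A →+ M}
    (h : ∀ u a, f (single u a) = g (single u a)) : f = g :=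
  Finsupp.addHom_ext h

variable [PartialDifferential n A]

/-- Left multiplication by `∂ᵢ`: `∂ᵢ (a ∂^v) = a ∂^{v + eᵢ} + (∂a/∂xᵢ) ∂^v`. -/
def leftDer (i : Fin n) : AddMonoid.End (DiffOp n A) :=
  Finsupp.liftAddHom fun v : Fin n →₀ ℕ =>
    (AddMonoidHom.mk' (fun a : A =>
      single (v + Finsupp.single i 1) a + single v (PartialDifferential.der i a)) (by
        intro a b
        simp only [map_add, single_add]
        abel) : A →+ DiffOp n A)

@[simp] theorem leftDer_single (i : Fin n) (v : Fin n →₀ ℕ) (a : A) :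
    leftDer i (single v a) =
      single (v + Finsupp.single i 1) a + single v (PartialDifferential.der i a) :=
  Finsupp.liftAddHom_apply_single _ _ _

theorem leftDer_comm (i j : Fin n) : Commute (leftDer (A := A) i) (leftDer j) := by
  refine addHom_ext fun u a => ?_
  change leftDer i (leftDer j _) = leftDer j (leftDer i _)
  simp only [leftDer_single, map_add, PartialDifferential.der_comm i j,
    add_right_comm u (Finsupp.single i 1)]
  abel

theorem leftDer_smul (i : Fin n) (a : A) (Q : DiffOp n A) :
    leftDer i (a • Q) = a • leftDer i Q + (PartialDifferential.der i a : A) • Q := by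
  have h : (leftDer i : DiffOp n A →+ DiffOp n A).comp (DistribSMul.toAddMonoidHom _ a) =
      (DistribSMul.toAddMonoidHom _ a).comp (leftDer i : DiffOp n A →+ DiffOp n A) +
        DistribSMul.toAddMonoidHom _ (PartialDifferential.der i a : A) := by
    refine addHom_ext fun u b => ?_
    change leftDer i (a • single u b) = a • leftDer i (single u b) + PartialDifferential.der i a • single u b
    simp only [leftDer_single, smul_add, smul_single, PartialDifferential.der_mul, single_add,
      add_assoc]
  exact DFunLike.congr_fun h Q

/-- `leftMul P Q = ∑_u p_u ∂^u Q` for `P = ∑_u p_u ∂^u`. -/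
def leftMul : DiffOp n A →+ DiffOp n A →+ DiffOp n A :=
  Finsupp.liftAddHom fun u : Fin n →₀ ℕ =>
    (AddMonoidHom.mk' (fun a : A =>
      (DistribSMul.toAddMonoidHom (DiffOp n A) a).comp
        (monomialPow leftDer u : AddMonoid.End (DiffOp n A))) (by
        intro a b
        ext Q
        exact add_smul a b _) : A →+ DiffOp n A →+ DiffOp n A)

theorem leftMul_single (u : Fin n →₀ ℕ) (a : A) (Q : DiffOp n A) :
    leftMul (single u a) Q = a • monomialPow leftDer u Q :=
  DFunLike.congr_fun (Finsupp.liftAddHom_apply_single (M := A) (N := DiffOp n A →+ DiffOp n A)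
    (fun u : Fin n →₀ ℕ => AddMonoidHom.mk' (fun a : A =>
      (DistribSMul.toAddMonoidHom (DiffOp n A) a).comp
        (monomialPow leftDer u : AddMonoid.End (DiffOp n A))) _) u a) Q

theorem leftMul_smul (a : A) (P Q : DiffOp n A) : leftMul (a • P) Q = a • leftMul P Q := by
  have h : ((leftMul.flip Q).comp (DistribSMul.toAddMonoidHom (DiffOp n A) a)) =
      (DistribSMul.toAddMonoidHom (DiffOp n A) a).comp (leftMul.flip Q) := by
    refine addHom_ext fun u b => ?_
    change leftMul (a • single u b) Q = a • leftMul (single u b) Q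
    rw [smul_single, leftMul_single, leftMul_single, mul_smul]
  exact DFunLike.congr_fun h P

theorem leftMul_leftDer (i : Fin n) (P Q : DiffOp n A) :
    leftMul (leftDer i P) Q = leftDer i (leftMul P Q) := by
  have h : (leftMul.flip Q).comp (leftDer i : DiffOp n A →+ DiffOp n A) =
      (leftDer i : DiffOp n A →+ DiffOp n A).comp (leftMul.flip Q) := by
    refine addHom_ext fun u b => ?_
    change leftMul (leftDer i (single u b)) Q = leftDer i (leftMul (single u b) Q)
    rw [leftDer_single, map_add, AddMonoidHom.add_apply, leftMul_single, leftMul_single,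
      leftMul_single, leftDer_smul, add_comm u, monomialPow_add _ leftDer_comm,
      monomialPow_single]
    rfl
  exact DFunLike.congr_fun h P

theorem leftMul_monomialPow (u : Fin n →₀ ℕ) (P Q : DiffOp n A) :
    leftMul (monomialPow leftDer u P) Q = monomialPow leftDer u (leftMul P Q) := by
  have hpow : ∀ (i : Fin n) (k : ℕ) (P : DiffOp n A),
      leftMul ((leftDer i ^ k) P) Q = (leftDer i ^ k) (leftMul P Q) := by
    intro i k
    induction k with
    | zero => intro P; rfl
    | succ k ih =>
      intro P
      rw [pow_succ]
      change leftMul ((leftDer i ^ k) (leftDer i P)) Q = (leftDer i ^ k) (leftDer i (leftMul P Q))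
      rw [ih, leftMul_leftDer]
  unfold monomialPow
  induction List.finRange n with
  | nil => rfl
  | cons i l ih =>
    simp only [List.map_cons, List.prod_cons]
    change leftMul ((leftDer i ^ u i) _) Q = (leftDer i ^ u i) _
    rw [hpow]
    exact congrArg _ ih

theorem leftMul_assoc (P Q R : DiffOp n A) :
    leftMul (leftMul P Q) R = leftMul P (leftMul Q R) := by
  have h : (leftMul.flip R).comp (leftMul.flip Q) = leftMul.flip (leftMul Q R) := by
    refine addHom_ext fun u a => ?_
    change leftMul (leftMul (single u a) Q) R = leftMul (single u a) (leftMul Q R)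
    rw [leftMul_single, leftMul_single, leftMul_smul, leftMul_monomialPow]
  exact DFunLike.congr_fun h P

theorem monomialPow_leftDer_single_one (v w : Fin n →₀ ℕ) :
    monomialPow leftDer v (single w 1 : DiffOp n A) = single (v + w) 1 := by
  have hpow : ∀ (i : Fin n) (k : ℕ) (w : Fin n →₀ ℕ),
      (leftDer i ^ k) (single w 1 : DiffOp n A) = single (Finsupp.single i k + w) 1 := by
    intro i k
    induction k with
    | zero => intro w; simp
    | succ k ih =>
      intro w
      rw [pow_succ]
      rw [AddMonoid.End.coe_mul, Function.comp_apply, leftDer_single, PartialDifferential.der_one, single_zero, add_zero, ih,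
        Finsupp.single_add, add_assoc, add_comm w]
  have hl : ∀ l : List (Fin n),
      ((l.map fun i => leftDer i ^ v i).prod) (single w 1 : DiffOp n A) =
        single ((l.map fun i => Finsupp.single i (v i)).sum + w) 1 := by
    intro l
    induction l with
    | nil => simp
    | cons i l ih =>
      simp only [List.map_cons, List.prod_cons, List.sum_cons]
      rw [AddMonoid.End.coe_mul, Function.comp_apply, ih, hpow, add_assoc]
  unfold monomialPow
  rw [hl]
  congr 2
  rw [← List.sum_toFinset _ (List.nodup_finRange n)]
  simp only [List.toFinset_finRange]
  exact Finsupp.univ_sum_single v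

theorem leftMul_one (P : DiffOp n A) : leftMul P (single 0 1) = P := by
  have h : leftMul.flip (single 0 1 : DiffOp n A) = AddMonoidHom.id _ := by
    refine addHom_ext fun u a => ?_
    change leftMul (single u a) (single 0 1) = single u a
    rw [leftMul_single, monomialPow_leftDer_single_one, smul_single, mul_one, add_zero]
  exact DFunLike.congr_fun h P

theorem one_leftMul (P : DiffOp n A) : leftMul (single 0 1) P = P := by
  rw [leftMul_single, monomialPow_zero, one_smul]
  rfl

/-- The ring structure of `A[∂₁, …, ∂ₙ]`. -/
instance : Ring (DiffOp n A) :=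
  { (inferInstance : AddCommGroup (DiffOp n A)) with
    mul := fun P Q => leftMul P Q
    one := single 0 1
    left_distrib := fun P Q R => map_add (leftMul P) Q R
    right_distrib := fun P Q R => by
      change leftMul (P + Q) R = leftMul P R + leftMul Q R
      rw [map_add, AddMonoidHom.add_apply]
    zero_mul := fun P => by
      change leftMul 0 P = 0
      rw [map_zero, AddMonoidHom.zero_apply]
    mul_zero := fun P => map_zero (leftMul P)
    mul_assoc := leftMul_assoc
    one_mul := one_leftMul
    mul_one := leftMul_one }

theorem mul_def (P Q : DiffOp n A) : P * Q = leftMul P Q := rfl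

/-- The commutation rule `∂ᵢ ∂ⱼ = ∂ⱼ ∂ᵢ`. -/
theorem del_mul_del (i j : Fin n) :
    (single (Finsupp.single i 1) 1 * single (Finsupp.single j 1) 1 : DiffOp n A) =
      single (Finsupp.single j 1) 1 * single (Finsupp.single i 1) 1 := by
  simp only [mul_def, leftMul_single, monomialPow_leftDer_single_one, one_smul]
  rw [add_comm]

/-- The commutation rule `∂ᵢ a = a ∂ᵢ + ∂a/∂xᵢ`. -/
theorem del_mul_coeff (i : Fin n) (a : A) :
    (single (Finsupp.single i 1) 1 * single 0 a : DiffOp n A) =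
      single 0 a * single (Finsupp.single i 1) 1 +
        single 0 (PartialDifferential.der i a) := by
  simp only [mul_def, leftMul_single, monomialPow_single, monomialPow_zero, one_smul,
    leftDer_single, zero_add]
  change _ = a • single _ 1 + _
  rw [smul_single, mul_one]

/-- The operator `a ∂^u` is the product of `a` and `∂^u = ∂₁^{u₁} ⋯ ∂ₙ^{uₙ}`. -/
theorem single_eq_mul (u : Fin n →₀ ℕ) (a : A) :
    single u a =
      single 0 a * monomialPow (fun i => (single (Finsupp.single i 1) 1 : DiffOp n A)) u := by
  have hpow : ∀ (i : Fin n) (k : ℕ) (Q : DiffOp n A),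
      (single (Finsupp.single i 1) 1 : DiffOp n A) ^ k * Q = (leftDer i ^ k) Q := by
    intro i k Q
    induction k with
    | zero => rw [pow_zero, one_mul]; rfl
    | succ k ih =>
      rw [pow_succ', mul_assoc, ih, mul_def, leftMul_single, monomialPow_single, one_smul,
        pow_succ']
      rfl
  have h : monomialPow (fun i => (single (Finsupp.single i 1) 1 : DiffOp n A)) u =
      monomialPow leftDer u (1 : DiffOp n A) := by
    unfold monomialPow
    induction List.finRange n with
    | nil => rfl
    | cons i l ih =>
      simp only [List.map_cons, List.prod_cons]
      rw [ih, hpow]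
      rfl
  rw [h]
  change single u a = leftMul (single 0 a) (monomialPow leftDer u (single 0 1))
  rw [monomialPow_leftDer_single_one, leftMul_single, monomialPow_zero, add_zero]
  change _ = a • single u 1
  rw [smul_single, mul_one]

instance : IsScalarTower A (DiffOp n A) (DiffOp n A) := ⟨leftMul_smul⟩

end DiffOp

/-! ### The rings `K(x)[∂]` and `K[x][∂]` -/

section Operators

variable (n : ℕ) (K : Type*) [Field K]

/-- The field `K(x₁, …, xₙ)`. -/
abbrev RatFun : Type _ := FractionRing (MvPolynomial (Fin n) K)

/-- The ring `K(x)[∂]`. -/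
abbrev RatOp : Type _ := DiffOp n (RatFun n K)

/-- The Weyl algebra `K[x][∂]`. -/
abbrev WeylAlgebra : Type _ := DiffOp n (MvPolynomial (Fin n) K)

variable {n K}

/-- The inclusion of `K[x][∂]` in `K(x)[∂]`. -/
def WeylAlgebra.toRatOp (P : WeylAlgebra n K) : RatOp n K :=
  Finsupp.mapRange (algebraMap (MvPolynomial (Fin n) K) (RatFun n K)) (map_zero _) P

/-- The natural action `P(f) = ∑_u c_u ∂^u(f)` of `P = ∑_u c_u ∂^u` on a formal power series. -/
def WeylAlgebra.act (P : WeylAlgebra n K) (f : MvPowerSeries (Fin n) K) :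
    MvPowerSeries (Fin n) K :=
  ∑ u ∈ P.support, MvPolynomial.toMvPowerSeries (P.coeff u) *
    monomialPow
      (fun i => (MvPowerSeries.pderiv K i : Module.End K (MvPowerSeries (Fin n) K))) u f

end Operators

/-! ### Gröbner bases -/

section Groebner

variable {n : ℕ} {A : Type*} [CommRing A]

/-- A monomial ordering is graded if `|u| < |v|` implies `u ≺ v`. -/
def IsGraded (m : MonomialOrder (Fin n)) : Prop :=
  ∀ u v : Fin n →₀ ℕ, u.degree < v.degree → u ≺[m] v

/-- The exponent of the head term of `P`, that is, the highest exponent that appears in `P`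
(and `0` if `P = 0`). -/
def headExp (m : MonomialOrder (Fin n)) (P : DiffOp n A) : Fin n →₀ ℕ :=
  m.toSyn.symm (P.support.sup m.toSyn)

/-- The head coefficient of `P`. -/
def headCoeff (m : MonomialOrder (Fin n)) (P : DiffOp n A) : A :=
  P.coeff (headExp m P)

/-- `S` is a Gröbner basis (of the left ideal that it generates): its elements are nonzero, and the
head term of every nonzero element of the left ideal is divisible by the head term of an element
of `S`. -/
def IsGroebnerBasis [PartialDifferential n A] (m : MonomialOrder (Fin n))
    (S : Set (DiffOp n A)) : Prop :=
  0 ∉ S ∧ ∀ P ∈ Ideal.span S, P ≠ 0 → ∃ g ∈ S, headExp m g ≤ headExp m P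

/-- No term that appears in an element of `S` is divisible by the head term of another one. -/
def IsReducedSet (m : MonomialOrder (Fin n)) (S : Set (DiffOp n A)) : Prop :=
  ∀ g ∈ S, ∀ h ∈ S, h ≠ g → ∀ u ∈ g.support, ¬ headExp m h ≤ u

variable {K : Type*} [Field K]

/-- An operator with polynomial coefficients is primitive if the gcd of its coefficients is `1`,
that is, if every common divisor of them is a unit. -/
def IsPrimitiveOp (P : WeylAlgebra n K) : Prop :=
  ∀ p : MvPolynomial (Fin n) K, (∀ u, p ∣ P.coeff u) → IsUnit p

/-- `G ⊆ K[x][∂]` is a primitive Gröbner basis in `K(x)[∂]`: a finite reduced Gröbner basis in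
`K(x)[∂]`, whose elements are primitive operators in `K[x][∂]`. -/
structure IsPrimitiveGroebnerBasis (m : MonomialOrder (Fin n)) (G : Set (WeylAlgebra n K)) :
    Prop where
  finite : G.Finite
  groebner : IsGroebnerBasis m (WeylAlgebra.toRatOp '' G)
  reduced : IsReducedSet m (WeylAlgebra.toRatOp '' G)
  primitive : ∀ g ∈ G, IsPrimitiveOp g

/-- The left ideal `K(x)[∂] G`. -/
def leftIdeal (G : Set (WeylAlgebra n K)) : Ideal (RatOp n K) :=
  Ideal.span (WeylAlgebra.toRatOp '' G)

/-- `G` has finite rank: `K(x)[∂] / K(x)[∂] G` is finite-dimensional over `K(x)`. -/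
def HasFiniteRank (G : Set (WeylAlgebra n K)) : Prop :=
  Module.Finite (RatFun n K) (RatOp n K ⧸ leftIdeal G)

/-- `rank(G)`, the dimension of `K(x)[∂] / K(x)[∂] G` over `K(x)`. -/
def rank (G : Set (WeylAlgebra n K)) : ℕ :=
  Module.finrank (RatFun n K) (RatOp n K ⧸ leftIdeal G)

/-- `PE(G)`: the exponents of the terms that no head term of `G` divides. -/
def parametricExponents (m : MonomialOrder (Fin n)) (G : Set (WeylAlgebra n K)) :
    Set (Fin n →₀ ℕ) :=
  {u | ∀ g ∈ G, ¬ headExp m g.toRatOp ≤ u}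

/-- `α` is an ordinary point of `G` if no head coefficient of `G` vanishes at `α`. -/
def IsOrdinaryPoint (m : MonomialOrder (Fin n)) (G : Set (WeylAlgebra n K))
    (α : Fin n → AlgebraicClosure K) : Prop :=
  ∀ g ∈ G, MvPolynomial.aeval α (headCoeff m g) ≠ 0

/-- `f` is a formal power series solution of `G`. -/
def IsSolution (G : Set (WeylAlgebra n K)) (f : MvPowerSeries (Fin n) K) : Prop :=
  ∀ g ∈ G, g.act f = 0

/-- `u` is the initial exponent of `f`: the least exponent that appears in `f`. -/
def IsInitialExponent (m : MonomialOrder (Fin n)) (f : MvPowerSeries (Fin n) K)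
    (u : Fin n →₀ ℕ) : Prop :=
  MvPowerSeries.coeff u f ≠ 0 ∧ ∀ v, v ≺[m] u → MvPowerSeries.coeff v f = 0

end Groebner

end DFinite

end

noncomputable section

open scoped MonomialOrder

namespace DFinite

/-! Both directions evaluate operators at the origin. Left multiplication by `∂^w` shifts the head
term and keeps the head coefficient, so reducing modulo `I = K(x)[∂] G` divides only by head
coefficients of `G`.

Ordinary point to solutions. By the Gröbner property the terms `∂^v` with `v ∈ PE(G)` form a
`K(x)`-basis of the quotient by `I` (`parametricBasis`). Let `φ_v` be the coordinate at `∂^v`. If no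
head coefficient vanishes at the origin, every `φ_v(∂^u)` is regular there
(`exists_hasValueAtZero`), and one puts `f_v = ∑_u φ_v(∂^u)(0) x^u / u!`. By linearity the constant
term of `P(f_v)` is `φ_v(P)(0)` for every `P` in `K[x][∂]`. For `P = ∂^w g` this is zero, so all
Taylor coefficients of `g(f_v)` vanish. Reduction only introduces lower terms, so `φ_v(∂^u) = 0` for
`u ≺ v`, and `f_v` has initial exponent `v`.

Solutions to ordinary point. Given solutions `f_w` with initial exponents `w ∈ PE(G)`, the matrix
`(∂^v f_w)` is triangular at the origin with nonzero diagonal, hence invertible over `K[[x]]`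
(`isUnit_wronskian`). Since `G` is reduced, each `g ∈ G` is `c ∂^h` plus parametric terms, and
solving the linear system `g(f_w) = 0` shows that `c` divides all coefficients of `g` in `K[[x]]`.
By Krull's intersection theorem it divides them in the local ring of the origin
(`exists_dvd_mul_of_coe_dvd`). If `c(0) = 0`, a prime factor of `c` vanishing at the origin would
divide every coefficient of `g`, against primitivity. -/

theorem exponent_induction {n : ℕ} {p : (Fin n →₀ ℕ) → Prop} (w : Fin n →₀ ℕ) (zero : p 0)
    (add_single : ∀ i w, p w → p (w + Finsupp.single i 1)) : p w := by
  have key : ∀ w v : Fin n →₀ ℕ, p v → p (v + w) := by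
    intro w
    induction w using Finsupp.induction_linear with
    | zero => simp
    | add a b ha hb =>
      intro v hv
      rw [← add_assoc]
      exact hb _ (ha _ hv)
    | single i k =>
      induction k with
      | zero => simp
      | succ k ih =>
        intro v hv
        rw [Finsupp.single_add, ← add_assoc]
        exact add_single _ _ (ih v hv)
  simpa using key w 0 zero

theorem monomialPow_add_single {n : ℕ} {M : Type*} [Monoid M] (T : Fin n → M)
    (hT : ∀ i j, Commute (T i) (T j)) (w : Fin n →₀ ℕ) (i : Fin n) :
    monomialPow T (w + Finsupp.single i 1) = T i * monomialPow T w := by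
  rw [add_comm, monomialPow_add T hT, monomialPow_single]

/-! ### Coefficients of operators and left multiplication by `∂^w` -/

namespace DiffOp

variable {n : ℕ} {A : Type*} [CommRing A]

@[ext] theorem ext {P Q : DiffOp n A} (h : ∀ u, P.coeff u = Q.coeff u) : P = Q := Finsupp.ext h

theorem coeff_add (u : Fin n →₀ ℕ) (P Q : DiffOp n A) :
    coeff u (P + Q) = coeff u P + coeff u Q := rfl

/-- `coeff u` as an additive map. -/
def coeffHom (u : Fin n →₀ ℕ) : DiffOp n A →+ A := AddMonoidHom.mk' (coeff u) (coeff_add u)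

theorem coeffHom_apply (u : Fin n →₀ ℕ) (P : DiffOp n A) : coeffHom u P = coeff u P := rfl

theorem coeff_single (u v : Fin n →₀ ℕ) (a : A) :
    coeff v (single u a) = if u = v then a else 0 := Finsupp.single_apply

theorem mem_support {P : DiffOp n A} {u : Fin n →₀ ℕ} : u ∈ P.support ↔ P.coeff u ≠ 0 :=
  Finsupp.mem_support_iff

theorem sum_single (P : DiffOp n A) : ∑ u ∈ P.support, single u (P.coeff u) = P :=
  Finsupp.sum_single P

theorem eq_zero_of_support {P : DiffOp n A} (h : P.support = ∅) : P = 0 :=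
  Finsupp.support_eq_empty.1 h

theorem map_eq_sum {M : Type*} [AddCommGroup M] [Module A M] (φ : DiffOp n A →ₗ[A] M)
    (P : DiffOp n A) : φ P = ∑ u ∈ P.support, P.coeff u • φ (single u 1) := by
  conv_lhs => rw [← sum_single P, map_sum]
  refine Finset.sum_congr rfl fun u _ => ?_
  rw [← map_smul, smul_single, mul_one]

variable [PartialDifferential n A]

theorem coeff_leftDer (i : Fin n) (P : DiffOp n A) (v : Fin n →₀ ℕ) :
    coeff v (leftDer i P) =
      (if Finsupp.single i 1 ≤ v then coeff (v - Finsupp.single i 1) P else 0) +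
        PartialDifferential.der i (coeff v P) := by
  have h : (coeffHom v).comp (leftDer i : DiffOp n A →+ DiffOp n A) =
      (if Finsupp.single i 1 ≤ v then coeffHom (v - Finsupp.single i 1) else 0) +
      (PartialDifferential.der i).comp (coeffHom v) := by
    refine addHom_ext fun u a => ?_
    change coeffHom v (leftDer i (single u a)) =
      (if Finsupp.single i 1 ≤ v then coeffHom (v - Finsupp.single i 1) else 0 :
        DiffOp n A →+ A) (single u a) + PartialDifferential.der i (coeffHom v (single u a))
    rw [coeffHom_apply, coeffHom_apply, leftDer_single, coeff_add, coeff_single, coeff_single, coeff_single]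
    congr 1
    · split_ifs with h1 h2 h2
      · rw [coeffHom_apply, coeff_single, if_pos]
        rw [← h1, add_tsub_cancel_right]
      · exact absurd (h1 ▸ le_add_self) h2
      · rw [coeffHom_apply, coeff_single, if_neg]
        rintro rfl
        exact h1 (tsub_add_cancel_of_le h2)
      · rfl
    · split_ifs <;> simp
  refine (DFunLike.congr_fun h P).trans ?_
  rw [AddMonoidHom.add_apply]
  split_ifs <;> rfl

theorem monomialPow_leftDer_eq_mul (w : Fin n →₀ ℕ) (P : DiffOp n A) :
    monomialPow leftDer w P = single w 1 * P := by
  rw [mul_def, leftMul_single, one_smul]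

theorem monomialPow_leftDer_add_single (w : Fin n →₀ ℕ) (i : Fin n) (P : DiffOp n A) :
    monomialPow leftDer (w + Finsupp.single i 1) P = leftDer i (monomialPow leftDer w P) := by
  rw [monomialPow_add_single _ leftDer_comm]
  rfl

/-- Multiplication by `∂^w` shifts the head of an operator. -/
theorem coeff_monomialPow_leftDer (m : MonomialOrder (Fin n)) {P : DiffOp n A} {u : Fin n →₀ ℕ}
    (hP : ∀ v, u ≺[m] v → P.coeff v = 0) (w : Fin n →₀ ℕ) :
    coeff (w + u) (monomialPow leftDer w P) = coeff u P ∧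
      ∀ v, (w + u) ≺[m] v → coeff v (monomialPow leftDer w P) = 0 := by
  induction w using exponent_induction with
  | zero => simpa [monomialPow_zero] using hP
  | add_single i w ih =>
    have hlt : (w + u) ≺[m] (w + Finsupp.single i 1 + u) :=
      m.toSyn_strictMono (by
        rw [add_right_comm]
        exact lt_add_of_pos_right _ (pos_iff_ne_zero.2 (by simp)))
    rw [monomialPow_leftDer_add_single]
    refine ⟨?_, fun v hv => ?_⟩
    -- The Leibniz term differentiates the coefficient at `w + e_i + u`, which lies beyond the head
    -- of `∂^w P` and is zero. Only the shifted, undifferentiated coefficient remains.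
    · rw [coeff_leftDer, ih.2 _ hlt, map_zero, add_zero, if_pos]
      · rw [add_right_comm, add_tsub_cancel_right, ih.1]
      · rw [add_right_comm]; exact le_add_self
    · rw [coeff_leftDer, ih.2 v (hlt.trans hv), map_zero, add_zero]
      split_ifs with h
      · apply ih.2
        rw [← tsub_add_cancel_of_le h, add_right_comm, map_add, map_add _ (v - _)] at hv
        exact lt_of_add_lt_add_right hv
      · rfl

end DiffOp

/-! ### Head terms -/

section Head

variable {n : ℕ} {A : Type*} [CommRing A] {m : MonomialOrder (Fin n)}

theorem toSyn_headExp (P : DiffOp n A) : m.toSyn (headExp m P) = P.support.sup m.toSyn :=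
  m.toSyn.apply_symm_apply _

theorem le_headExp {P : DiffOp n A} {u : Fin n →₀ ℕ} (h : P.coeff u ≠ 0) :
    u ≼[m] headExp m P := by
  rw [toSyn_headExp]
  exact Finset.le_sup (f := m.toSyn) (DiffOp.mem_support.2 h)

theorem coeff_eq_zero_of_headExp_lt {P : DiffOp n A} {u : Fin n →₀ ℕ} (h : headExp m P ≺[m] u) :
    P.coeff u = 0 := by
  by_contra hu
  exact (le_headExp hu).not_gt h

theorem headCoeff_ne_zero {P : DiffOp n A} (h : P ≠ 0) : headCoeff m P ≠ 0 := by
  have hs : P.support.Nonempty := by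
    rw [Finset.nonempty_iff_ne_empty]
    exact fun hs => h (DiffOp.eq_zero_of_support hs)
  obtain ⟨u, hu, he⟩ := Finset.exists_mem_eq_sup _ hs m.toSyn
  have : headExp m P = u := m.toSyn.injective ((toSyn_headExp P).trans he)
  unfold headCoeff
  rw [this]
  exact DiffOp.mem_support.1 hu

end Head

/-! ### Operators with polynomial coefficients acting on power series -/

section Weyl

variable {n : ℕ} {K : Type*} [Field K]

namespace WeylAlgebra

theorem coeff_toRatOp (P : WeylAlgebra n K) (u : Fin n →₀ ℕ) :
    P.toRatOp.coeff u = algebraMap (MvPolynomial (Fin n) K) (RatFun n K) (P.coeff u) :=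
  Finsupp.mapRange_apply ..

theorem coeff_toRatOp_eq_zero {P : WeylAlgebra n K} {u : Fin n →₀ ℕ} :
    P.toRatOp.coeff u = 0 ↔ P.coeff u = 0 := by
  rw [coeff_toRatOp, map_eq_zero_iff _ (IsFractionRing.injective _ _)]

theorem support_toRatOp (P : WeylAlgebra n K) : P.toRatOp.support = P.support := by
  ext u
  rw [DiffOp.mem_support, DiffOp.mem_support, Ne, coeff_toRatOp_eq_zero]

theorem headExp_toRatOp (m : MonomialOrder (Fin n)) (P : WeylAlgebra n K) :
    headExp m P.toRatOp = headExp m P := by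
  unfold headExp
  rw [support_toRatOp]

theorem der_algebraMap (i : Fin n) (a : MvPolynomial (Fin n) K) :
    PartialDifferential.der i (algebraMap (MvPolynomial (Fin n) K) (RatFun n K) a) =
      algebraMap _ (RatFun n K) (PartialDifferential.der i a) := by
  have h := fracDer_div i a 1 one_ne_zero
  rw [PartialDifferential.der_one, map_one, div_one, mul_zero, sub_zero, mul_one, one_pow,
    div_one] at h
  exact h

theorem toRatOp_leftDer (i : Fin n) (P : WeylAlgebra n K) :
    toRatOp (DiffOp.leftDer i P) = DiffOp.leftDer i P.toRatOp := by
  ext v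
  rw [coeff_toRatOp, DiffOp.coeff_leftDer, DiffOp.coeff_leftDer, map_add, coeff_toRatOp,
    coeff_toRatOp, der_algebraMap, apply_ite (algebraMap _ _), map_zero]

theorem toRatOp_monomialPow_leftDer (w : Fin n →₀ ℕ) (P : WeylAlgebra n K) :
    toRatOp (monomialPow DiffOp.leftDer w P) = monomialPow DiffOp.leftDer w P.toRatOp := by
  induction w using exponent_induction with
  | zero => simp [monomialPow_zero]
  | add_single i w ih =>
    rw [DiffOp.monomialPow_leftDer_add_single, DiffOp.monomialPow_leftDer_add_single,
      toRatOp_leftDer, ih]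

/-- The additive map `P ↦ P(f)`. -/
def actHom (f : MvPowerSeries (Fin n) K) : WeylAlgebra n K →+ MvPowerSeries (Fin n) K :=
  Finsupp.liftAddHom fun u : Fin n →₀ ℕ =>
    (AddMonoidHom.mulRight (monomialPow
      (fun i => (MvPowerSeries.pderiv K i : Module.End K (MvPowerSeries (Fin n) K))) u f)).comp
      (MvPolynomial.coeToMvPowerSeries.ringHom (R := K)).toAddMonoidHom

theorem actHom_apply (P : WeylAlgebra n K) (f : MvPowerSeries (Fin n) K) :
    actHom f P = P.act f := rfl

theorem act_single (u : Fin n →₀ ℕ) (a : MvPolynomial (Fin n) K) (f : MvPowerSeries (Fin n) K) :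
    act (DiffOp.single u a) f = a.toMvPowerSeries * monomialPow
      (fun i => (MvPowerSeries.pderiv K i : Module.End K (MvPowerSeries (Fin n) K))) u f := by
  rw [← actHom_apply]
  exact Finsupp.liftAddHom_apply_single _ _ _

end WeylAlgebra

theorem commute_pderiv (i j : Fin n) :
    Commute (MvPowerSeries.pderiv K i : Module.End K (MvPowerSeries (Fin n) K))
      (MvPowerSeries.pderiv K j : Module.End K (MvPowerSeries (Fin n) K)) := by
  refine LinearMap.ext fun f => ?_
  ext v
  change MvPowerSeries.coeff v (MvPowerSeries.pderiv K i (MvPowerSeries.pderiv K j f)) =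
    MvPowerSeries.coeff v (MvPowerSeries.pderiv K j (MvPowerSeries.pderiv K i f))
  simp only [MvPowerSeries.coeff_pderiv, Finsupp.add_apply, Finsupp.single_apply]
  rw [add_right_comm]
  by_cases h : i = j
  · subst h; rfl
  · rw [if_neg h, if_neg (Ne.symm h)]
    push_cast
    ring

theorem monomialPow_pderiv_add_single (w : Fin n →₀ ℕ) (i : Fin n)
    (f : MvPowerSeries (Fin n) K) :
    monomialPow (fun i => (MvPowerSeries.pderiv K i : Module.End K (MvPowerSeries (Fin n) K)))
      (w + Finsupp.single i 1) f = MvPowerSeries.pderiv K i (monomialPow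
        (fun i => (MvPowerSeries.pderiv K i : Module.End K (MvPowerSeries (Fin n) K))) w f) := by
  rw [monomialPow_add_single _ commute_pderiv]
  rfl

/-- The Leibniz rule for `a · ∂^u f` matches the commutation rule of `∂_i` with `a`. This is the
case of `(QP)(f) = Q(P(f))` that the argument needs, since the ideal elements to be tested are the
`∂^w g`. -/
theorem WeylAlgebra.act_leftDer (i : Fin n) (P : WeylAlgebra n K) (f : MvPowerSeries (Fin n) K) :
    act (DiffOp.leftDer i P) f = MvPowerSeries.pderiv K i (P.act f) := by
  have h : (actHom f).comp (DiffOp.leftDer i : WeylAlgebra n K →+ WeylAlgebra n K) =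
      (MvPowerSeries.pderiv K i).toLinearMap.toAddMonoidHom.comp (actHom f) := by
    refine DiffOp.addHom_ext fun u a => ?_
    change actHom f (DiffOp.leftDer i (DiffOp.single u a)) =
      MvPowerSeries.pderiv K i (actHom f (DiffOp.single u a))
    rw [DiffOp.leftDer_single, map_add, actHom_apply, actHom_apply, actHom_apply, act_single,
      act_single, act_single, monomialPow_pderiv_add_single, Derivation.leibniz, smul_eq_mul,
      smul_eq_mul]
    congr 1
    rw [mul_comm]
    congr 1
    exact (MvPowerSeries.pderiv_coe a).symm
  exact DFunLike.congr_fun h P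

theorem WeylAlgebra.act_monomialPow_leftDer (w : Fin n →₀ ℕ) (P : WeylAlgebra n K)
    (f : MvPowerSeries (Fin n) K) :
    act (monomialPow DiffOp.leftDer w P) f = monomialPow
      (fun i => (MvPowerSeries.pderiv K i : Module.End K (MvPowerSeries (Fin n) K))) w
        (P.act f) := by
  induction w using exponent_induction with
  | zero => simp [monomialPow_zero]
  | add_single i w ih =>
    rw [DiffOp.monomialPow_leftDer_add_single, act_leftDer, ih, monomialPow_pderiv_add_single]

/-- `u! = u₁! ⋯ uₙ!`. -/
def multiFactorial (u : Fin n →₀ ℕ) : ℕ := ∏ i, (u i).factorial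

theorem multiFactorial_ne_zero (u : Fin n →₀ ℕ) : multiFactorial u ≠ 0 :=
  Finset.prod_ne_zero_iff.2 fun i _ => (u i).factorial_ne_zero

theorem multiFactorial_add_single (u : Fin n →₀ ℕ) (i : Fin n) :
    multiFactorial (u + Finsupp.single i 1) = (u i + 1) * multiFactorial u := by
  unfold multiFactorial
  rw [← Finset.mul_prod_erase _ _ (Finset.mem_univ i),
    ← Finset.mul_prod_erase _ (fun i => (u i).factorial) (Finset.mem_univ i), ← mul_assoc]
  congr 1
  · simp [Nat.factorial_succ]
  · refine Finset.prod_congr rfl fun j hj => ?_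
    simp [(Finset.ne_of_mem_erase hj)]

theorem coeff_monomialPow_pderiv (w : Fin n →₀ ℕ) (f : MvPowerSeries (Fin n) K)
    (v : Fin n →₀ ℕ) :
    MvPowerSeries.coeff v (monomialPow (fun i => (MvPowerSeries.pderiv K i :
      Module.End K (MvPowerSeries (Fin n) K))) w f) * multiFactorial v =
        MvPowerSeries.coeff (w + v) f * multiFactorial (w + v) := by
  induction w using exponent_induction generalizing v with
  | zero => simp [monomialPow_zero]
  | add_single i w ih =>
    have h := ih (v + Finsupp.single i 1)
    rw [monomialPow_pderiv_add_single, MvPowerSeries.coeff_pderiv, add_assoc w, add_comm _ v, ← h,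
      multiFactorial_add_single]
    push_cast
    ring

theorem constantCoeff_monomialPow_pderiv (w : Fin n →₀ ℕ) (f : MvPowerSeries (Fin n) K) :
    MvPowerSeries.constantCoeff (monomialPow (fun i => (MvPowerSeries.pderiv K i :
      Module.End K (MvPowerSeries (Fin n) K))) w f) =
        multiFactorial w * MvPowerSeries.coeff w f := by
  have h := coeff_monomialPow_pderiv w f 0
  rw [add_zero] at h
  rw [mul_comm, ← h]
  simp [multiFactorial]

theorem constantCoeff_coe (p : MvPolynomial (Fin n) K) :
    MvPowerSeries.constantCoeff p.toMvPowerSeries = MvPolynomial.constantCoeff p := by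
  rw [← MvPowerSeries.coeff_zero_eq_constantCoeff_apply, MvPolynomial.constantCoeff_eq]
  exact MvPolynomial.coeff_coe _ _

theorem constantCoeff_act (P : WeylAlgebra n K) (f : MvPowerSeries (Fin n) K) :
    MvPowerSeries.constantCoeff (P.act f) = ∑ u ∈ P.support,
      MvPolynomial.constantCoeff (P.coeff u) *
        (multiFactorial u * MvPowerSeries.coeff u f) := by
  unfold WeylAlgebra.act
  simp only [map_sum, map_mul, constantCoeff_monomialPow_pderiv, constantCoeff_coe]

/-- In characteristic zero a series vanishes as soon as all its derivatives have constant term zero.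
Being a solution thereby becomes a family of conditions at the origin, one for each `∂^w g`. -/
theorem isSolution_iff [CharZero K] {G : Set (WeylAlgebra n K)} {f : MvPowerSeries (Fin n) K} :
    IsSolution G f ↔ ∀ g ∈ G, ∀ w, MvPowerSeries.constantCoeff
      (WeylAlgebra.act (monomialPow DiffOp.leftDer w g) f) = 0 := by
  refine forall₂_congr fun g _ => ⟨fun h w => ?_, fun h => ?_⟩
  · rw [WeylAlgebra.act_monomialPow_leftDer, h, map_zero, map_zero]
  · ext w
    have h := h w
    rw [WeylAlgebra.act_monomialPow_leftDer, constantCoeff_monomialPow_pderiv] at h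
    exact (mul_eq_zero.1 h).resolve_left (Nat.cast_ne_zero.2 (multiFactorial_ne_zero w))

end Weyl

end DFinite

namespace DFinite

variable {n : ℕ} {K : Type*} [Field K]

/-! ### Values of rational functions at the origin -/

section RegularValue

/-- The rational function `a` has a representation `b / h` with `h(0) ≠ 0`, and `a(0) = c`. -/
def HasValueAtZero (a : RatFun n K) (c : K) : Prop :=
  ∃ b h : MvPolynomial (Fin n) K, MvPolynomial.constantCoeff h ≠ 0 ∧
    a * algebraMap _ (RatFun n K) h = algebraMap _ (RatFun n K) b ∧
      MvPolynomial.constantCoeff b = c * MvPolynomial.constantCoeff h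

theorem hasValueAtZero_algebraMap (p : MvPolynomial (Fin n) K) :
    HasValueAtZero (algebraMap _ (RatFun n K) p) (MvPolynomial.constantCoeff p) :=
  ⟨p, 1, by simp, by simp, by simp⟩

theorem HasValueAtZero.add {a a' : RatFun n K} {c c' : K} (ha : HasValueAtZero a c)
    (ha' : HasValueAtZero a' c') : HasValueAtZero (a + a') (c + c') := by
  obtain ⟨b, h, h0, e, ec⟩ := ha
  obtain ⟨b', h', h0', e', ec'⟩ := ha'
  refine ⟨b * h' + b' * h, h * h', by simp [h0, h0'], ?_, ?_⟩
  · simp only [map_add, map_mul, ← e, ← e']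
    ring
  · simp only [map_add, map_mul, ec, ec']
    ring

theorem HasValueAtZero.mul {a a' : RatFun n K} {c c' : K} (ha : HasValueAtZero a c)
    (ha' : HasValueAtZero a' c') : HasValueAtZero (a * a') (c * c') := by
  obtain ⟨b, h, h0, e, ec⟩ := ha
  obtain ⟨b', h', h0', e', ec'⟩ := ha'
  refine ⟨b * b', h * h', by simp [h0, h0'], ?_, ?_⟩
  · simp only [map_mul, ← e, ← e']
    ring
  · simp only [map_mul, ec, ec']
    ring

theorem HasValueAtZero.sum {ι : Type*} (s : Finset ι) {a : ι → RatFun n K} {c : ι → K}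
    (h : ∀ i ∈ s, HasValueAtZero (a i) (c i)) :
    HasValueAtZero (∑ i ∈ s, a i) (∑ i ∈ s, c i) := by
  classical
  induction s using Finset.induction_on with
  | empty => simpa using hasValueAtZero_algebraMap (K := K) (n := n) 0
  | insert i s hi ih =>
    rw [Finset.sum_insert hi, Finset.sum_insert hi]
    exact (h i (Finset.mem_insert_self ..)).add
      (ih fun j hj => h j (Finset.mem_insert_of_mem hj))

theorem HasValueAtZero.eq_zero {c : K} (h : HasValueAtZero (0 : RatFun n K) c) : c = 0 := by
  obtain ⟨b, h, h0, e, ec⟩ := h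
  rw [zero_mul, eq_comm, map_eq_zero_iff _ (IsFractionRing.injective _ _)] at e
  rw [e, map_zero, eq_comm] at ec
  exact (mul_eq_zero.1 ec).resolve_right h0

theorem HasValueAtZero.unique {a : RatFun n K} {c c' : K} (h : HasValueAtZero a c)
    (h' : HasValueAtZero a c') : c = c' := by
  have e := h.add ((hasValueAtZero_algebraMap (n := n) (K := K) (-1)).mul h')
  rw [map_neg, map_one, neg_one_mul, add_neg_cancel] at e
  have e := e.eq_zero
  rw [map_neg, map_one, neg_one_mul, ← sub_eq_add_neg] at e
  exact sub_eq_zero.1 e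

/-- The division step of a reduction: it preserves regularity because the divisor is a unit in the
local ring of the origin. -/
theorem HasValueAtZero.of_mul {p : MvPolynomial (Fin n) K}
    (hp : MvPolynomial.constantCoeff p ≠ 0) {a : RatFun n K} {c : K}
    (h : HasValueAtZero (algebraMap _ (RatFun n K) p * a) c) :
    HasValueAtZero a (c / MvPolynomial.constantCoeff p) := by
  obtain ⟨b, h, h0, e, ec⟩ := h
  refine ⟨b, p * h, by simp [h0, hp], ?_, ?_⟩
  · rw [← e, map_mul]
    ring
  · rw [ec, map_mul]
    field_simp

end RegularValue

/-! ### Reduction modulo the left ideal and the basis of parametric terms -/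

section Reduction

variable {m : MonomialOrder (Fin n)} {G : Set (WeylAlgebra n K)}

theorem monomialPow_leftDer_mem_leftIdeal {g : WeylAlgebra n K} (hg : g ∈ G) (w : Fin n →₀ ℕ) :
    WeylAlgebra.toRatOp (monomialPow DiffOp.leftDer w g) ∈ leftIdeal G := by
  rw [WeylAlgebra.toRatOp_monomialPow_leftDer, DiffOp.monomialPow_leftDer_eq_mul]
  exact Ideal.mul_mem_left _ _ (Ideal.subset_span ⟨g, hg, rfl⟩)

/-- A term outside of `PE(G)` is the head term of an element of the left ideal with the same head
coefficient as some element of `G`. -/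
theorem exists_mem_leftIdeal_of_notMem_parametricExponents {u : Fin n →₀ ℕ}
    (hu : u ∉ parametricExponents m G) :
    ∃ g ∈ G, ∃ P : WeylAlgebra n K, P.toRatOp ∈ leftIdeal G ∧ P.coeff u = headCoeff m g ∧
      ∀ v ∈ P.support, v ≠ u → v ≺[m] u := by
  simp only [parametricExponents, Set.mem_ofPred_eq, not_forall, not_not] at hu
  obtain ⟨g, hg, hle⟩ := hu
  rw [WeylAlgebra.headExp_toRatOp] at hle
  obtain ⟨h1, h2⟩ := DiffOp.coeff_monomialPow_leftDer m (P := g) (u := headExp m g)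
    (fun v hv => coeff_eq_zero_of_headExp_lt hv) (u - headExp m g)
  rw [tsub_add_cancel_of_le hle] at h1 h2
  refine ⟨g, hg, _, monomialPow_leftDer_mem_leftIdeal hg (u - headExp m g), h1,
    fun v hv hne => ?_⟩
  by_contra hlt
  exact DiffOp.mem_support.1 hv
    (h2 v (lt_of_le_of_ne (not_lt.1 hlt) fun e => hne (m.toSyn.injective e).symm))

theorem IsPrimitiveGroebnerBasis.ne_zero (hG : IsPrimitiveGroebnerBasis m G)
    {g : WeylAlgebra n K} (hg : g ∈ G) : g ≠ 0 := by
  rintro rfl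
  refine hG.groebner.1 ⟨0, hg, ?_⟩
  ext u
  rw [WeylAlgebra.coeff_toRatOp]
  exact map_zero _

theorem smul_single_add_sum (φ : RatOp n K →ₗ[RatFun n K] RatFun n K) {P : WeylAlgebra n K}
    {u : Fin n →₀ ℕ} (hu : P.coeff u ≠ 0) :
    φ P.toRatOp = algebraMap _ (RatFun n K) (P.coeff u) * φ (DiffOp.single u 1) +
      ∑ v ∈ P.support.erase u,
        algebraMap _ (RatFun n K) (P.coeff v) * φ (DiffOp.single v 1) := by
  rw [DiffOp.map_eq_sum φ, WeylAlgebra.support_toRatOp,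
    ← Finset.add_sum_erase _ _ (DiffOp.mem_support.2 hu)]
  simp only [WeylAlgebra.coeff_toRatOp, smul_eq_mul]

/-- Modulo the left ideal, every term is a linear combination of lower parametric terms. -/
theorem single_mem_sup_span (hG : IsPrimitiveGroebnerBasis m G) (u : Fin n →₀ ℕ) :
    (DiffOp.single u 1 : RatOp n K) ∈ (leftIdeal G).restrictScalars (RatFun n K) ⊔
      Submodule.span (RatFun n K) ((fun v => DiffOp.single v 1) ''
        {v | v ∈ parametricExponents m G ∧ v ≼[m] u}) := by
  induction hs : m.toSyn u using WellFoundedLT.induction generalizing u with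
  | ind s ih =>
    subst hs
    by_cases hu : u ∈ parametricExponents m G
    · exact Submodule.mem_sup_right (Submodule.subset_span ⟨u, ⟨hu, le_rfl⟩, rfl⟩)
    obtain ⟨g, hg, P, hP, hc, hlt⟩ := exists_mem_leftIdeal_of_notMem_parametricExponents hu
    have hc0 : P.coeff u ≠ 0 := hc ▸ headCoeff_ne_zero (hG.ne_zero hg)
    set S := (leftIdeal G).restrictScalars (RatFun n K) ⊔
      Submodule.span (RatFun n K) ((fun v => DiffOp.single v 1) ''
        {v | v ∈ parametricExponents m G ∧ v ≼[m] u}) with hS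
    have hsum : P.toRatOp = P.toRatOp.coeff u • DiffOp.single u 1 +
        ∑ v ∈ P.support.erase u, P.toRatOp.coeff v • DiffOp.single v 1 := by
      have h := DiffOp.map_eq_sum LinearMap.id P.toRatOp
      rwa [WeylAlgebra.support_toRatOp, LinearMap.id_apply,
        ← Finset.add_sum_erase _ _ (DiffOp.mem_support.2 hc0)] at h
    have hrest : ∑ v ∈ P.support.erase u, P.toRatOp.coeff v • DiffOp.single v 1 ∈ S := by
      refine Submodule.sum_mem _ fun v hv => Submodule.smul_mem _ _ ?_
      have hvu := hlt v (Finset.mem_of_mem_erase hv) (Finset.ne_of_mem_erase hv)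
      have hsub : {w | w ∈ parametricExponents m G ∧ w ≼[m] v} ⊆
          {w | w ∈ parametricExponents m G ∧ w ≼[m] u} :=
        fun w hw => ⟨hw.1, hw.2.trans hvu.le⟩
      have hle : (leftIdeal G).restrictScalars (RatFun n K) ⊔
          Submodule.span (RatFun n K) ((fun v => DiffOp.single v 1) ''
            {w | w ∈ parametricExponents m G ∧ w ≼[m] v}) ≤ S :=
        sup_le_sup le_rfl (Submodule.span_mono (Set.image_mono hsub))
      exact hle (ih _ hvu v rfl)
    -- `P` lies in the ideal and its lower terms lie in `S` by induction, so the head term of `P`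
    -- does too, up to a nonzero scalar.
    have hP' : P.toRatOp ∈ S := Submodule.mem_sup_left hP
    rw [hsum] at hP'
    have h := (Submodule.add_mem_iff_left _ hrest).1 hP'
    refine (Submodule.smul_mem_iff _ ?_).1 h
    exact fun h => hc0 (WeylAlgebra.coeff_toRatOp_eq_zero.1 h)

/-- Since `φ` kills the ideal, `φ(∂^u)` is obtained from values at lower terms by polynomial
combinations and one division by a head coefficient of `G`. Well-founded induction along the
ordering then spreads regularity from the parametric terms to all terms. -/
theorem exists_hasValueAtZero (hG : ∀ g ∈ G, MvPolynomial.constantCoeff (headCoeff m g) ≠ 0)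
    (φ : RatOp n K →ₗ[RatFun n K] RatFun n K) (hφ : ∀ P ∈ leftIdeal G, φ P = 0)
    (hPE : ∀ v ∈ parametricExponents m G, ∃ c, HasValueAtZero (φ (DiffOp.single v 1)) c)
    (u : Fin n →₀ ℕ) : ∃ c, HasValueAtZero (φ (DiffOp.single u 1)) c := by
  induction hs : m.toSyn u using WellFoundedLT.induction generalizing u with
  | ind s ih =>
    subst hs
    by_cases hu : u ∈ parametricExponents m G
    · exact hPE u hu
    obtain ⟨g, hg, P, hP, hc, hlt⟩ := exists_mem_leftIdeal_of_notMem_parametricExponents hu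
    have hc0 : P.coeff u ≠ 0 := fun h => hG g hg (by rw [← hc, h, map_zero])
    have hrest : ∃ c, HasValueAtZero (∑ v ∈ P.support.erase u,
        algebraMap _ (RatFun n K) (P.coeff v) * φ (DiffOp.single v 1)) c := by
      have h : ∀ v ∈ P.support.erase u, ∃ c, HasValueAtZero (φ (DiffOp.single v 1)) c :=
        fun v hv => ih _ (hlt v (Finset.mem_of_mem_erase hv) (Finset.ne_of_mem_erase hv)) v rfl
      choose! c hc using h
      exact ⟨_, HasValueAtZero.sum _ fun v hv => (hasValueAtZero_algebraMap _).mul (hc v hv)⟩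
    obtain ⟨c, hc'⟩ := hrest
    have e := hφ _ hP
    rw [smul_single_add_sum φ hc0] at e
    have h := (hasValueAtZero_algebraMap (n := n) (K := K) (-1)).mul hc'
    rw [map_neg, map_one, neg_one_mul, ← eq_neg_of_add_eq_zero_left e] at h
    exact ⟨_, HasValueAtZero.of_mul (by rw [hc]; exact hG g hg) h⟩

/-- The quotient map onto `K(x)[∂] / K(x)[∂] G`. -/
def quotientMap (G : Set (WeylAlgebra n K)) :
    RatOp n K →ₗ[RatFun n K] RatOp n K ⧸ leftIdeal G :=
  (leftIdeal G).mkQ.restrictScalars (RatFun n K)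

theorem quotientMap_eq_zero {P : RatOp n K} : quotientMap G P = 0 ↔ P ∈ leftIdeal G :=
  Submodule.Quotient.mk_eq_zero _

/-- A nontrivial relation would be a nonzero element of the ideal all of whose exponents are
parametric. Its head term would then be divisible by no head term of `G`, against the Gröbner
property. -/
theorem linearIndependent_parametricTerms (hG : IsPrimitiveGroebnerBasis m G) :
    LinearIndependent (RatFun n K) fun v : parametricExponents m G =>
      quotientMap G (DiffOp.single v.1 1) := by
  rw [linearIndependent_iff]
  intro l hl
  let P : RatOp n K := l.mapDomain Subtype.val
  have hcoeff : ∀ v : parametricExponents m G, P.coeff v.1 = l v := fun v =>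
    Finsupp.mapDomain_apply Subtype.val_injective l v
  have hP : P ∈ leftIdeal G := by
    rw [← quotientMap_eq_zero, ← hl, Finsupp.linearCombination_apply, ← Finsupp.sum_mapDomain_index
      (f := Subtype.val) (h := fun v a => a • quotientMap G (DiffOp.single v 1))
      (by simp) (by simp [add_smul])]
    exact DiffOp.map_eq_sum _ P
  by_contra hne
  have hP0 : P ≠ 0 := fun h => hne (Finsupp.ext fun v => by
    rw [← hcoeff, h]; rfl)
  obtain ⟨_, ⟨g, hg, rfl⟩, hle⟩ := hG.groebner.2 P hP hP0
  -- `P` has coefficient zero outside `PE(G)`, and the head exponent of `P` is outside because the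
  -- head of `g` divides it.
  refine headCoeff_ne_zero (m := m) hP0 (Finsupp.mapDomain_of_notMem_range _ _ ?_)
  rintro ⟨v, hv⟩
  exact v.2 g hg (hv ▸ hle)

/-- The parametric terms form a basis of `K(x)[∂] / K(x)[∂] G`. -/
def parametricBasis (hG : IsPrimitiveGroebnerBasis m G) :
    Module.Basis (parametricExponents m G) (RatFun n K) (RatOp n K ⧸ leftIdeal G) :=
  Module.Basis.mk (linearIndependent_parametricTerms hG) (by
    intro x _
    obtain ⟨P, rfl⟩ := (leftIdeal G).mkQ_surjective x
    change quotientMap G P ∈ _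
    rw [DiffOp.map_eq_sum]
    refine Submodule.sum_mem _ fun u _ => Submodule.smul_mem _ _ ?_
    obtain ⟨Q, hQ, R, hR, e⟩ := Submodule.mem_sup.1 (single_mem_sup_span hG u)
    rw [← e, map_add, quotientMap_eq_zero.2 hQ, zero_add]
    have h := Submodule.mem_map_of_mem (f := quotientMap G) hR
    rw [Submodule.map_span] at h
    refine Submodule.span_mono ?_ h
    rintro _ ⟨_, ⟨v, hv, rfl⟩, rfl⟩
    exact ⟨⟨v, hv.1⟩, rfl⟩)

theorem parametricBasis_apply (hG : IsPrimitiveGroebnerBasis m G) (v : parametricExponents m G) :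
    parametricBasis hG v = quotientMap G (DiffOp.single v.1 1) :=
  Module.Basis.mk_apply _ _ v

theorem finite_parametricExponents (hG : IsPrimitiveGroebnerBasis m G) (hr : HasFiniteRank G) :
    Finite (parametricExponents m G) :=
  haveI : Module.Finite (RatFun n K) (RatOp n K ⧸ leftIdeal G) := hr
  Module.Finite.finite_basis (parametricBasis hG)

theorem rank_eq_card (hG : IsPrimitiveGroebnerBasis m G) :
    rank G = Nat.card (parametricExponents m G) :=
  Module.finrank_eq_nat_card_basis (parametricBasis hG)

/-- The coordinate of an operator at a parametric term. -/
def parametricCoord (hG : IsPrimitiveGroebnerBasis m G) (v : parametricExponents m G) :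
    RatOp n K →ₗ[RatFun n K] RatFun n K :=
  ((parametricBasis hG).coord v).comp (quotientMap G)

theorem parametricCoord_of_mem (hG : IsPrimitiveGroebnerBasis m G) (v : parametricExponents m G)
    {P : RatOp n K} (hP : P ∈ leftIdeal G) : parametricCoord hG v P = 0 := by
  rw [parametricCoord, LinearMap.comp_apply, quotientMap_eq_zero.2 hP, map_zero]

theorem parametricCoord_single [DecidableEq (parametricExponents m G)]
    (hG : IsPrimitiveGroebnerBasis m G) (v w : parametricExponents m G) :
    parametricCoord hG v (DiffOp.single w.1 1) = if w = v then 1 else 0 := by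
  rw [parametricCoord, LinearMap.comp_apply, ← parametricBasis_apply hG, Module.Basis.coord_apply,
    Module.Basis.repr_self, Finsupp.single_apply]

/-- Reducing `∂^u` only produces parametric terms up to `u`, so `∂^v` cannot appear. This yields the
initial exponents of the solutions. -/
theorem parametricCoord_single_of_lt (hG : IsPrimitiveGroebnerBasis m G)
    (v : parametricExponents m G) {u : Fin n →₀ ℕ} (hu : u ≺[m] v.1) :
    parametricCoord hG v (DiffOp.single u 1) = 0 := by
  classical
  have h := single_mem_sup_span hG u
  rw [← LinearMap.mem_ker]
  refine (sup_le (fun P hP => ?_) (Submodule.span_le.2 ?_) :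
    _ ≤ LinearMap.ker (parametricCoord hG v)) h
  · exact parametricCoord_of_mem hG v hP
  · rintro _ ⟨w, ⟨hw, hwu⟩, rfl⟩
    refine (parametricCoord_single hG v ⟨w, hw⟩).trans (if_neg ?_)
    rintro rfl
    exact (hwu.trans_lt hu).false

end Reduction

end DFinite

namespace DFinite

variable {n : ℕ} {K : Type*} [Field K]

/-! ### Descending divisibility from power series to polynomials -/

section Divisibility

theorem mem_idealOfVars_iff {p : MvPolynomial (Fin n) K} :
    p ∈ MvPolynomial.idealOfVars (Fin n) K ↔ MvPolynomial.constantCoeff p = 0 := by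
  rw [← pow_one (MvPolynomial.idealOfVars (Fin n) K), MvPolynomial.mem_pow_idealOfVars_iff',
    MvPolynomial.constantCoeff_eq]
  refine ⟨fun h => h 0 (by simp), fun h x hx => ?_⟩
  rw [Nat.lt_one_iff, Finsupp.degree_eq_zero_iff] at hx
  rwa [hx]

/-- Divisibility of polynomials in the power series ring implies divisibility in the local ring
of the origin. -/
theorem exists_dvd_mul_of_coe_dvd {p q : MvPolynomial (Fin n) K}
    (h : p.toMvPowerSeries ∣ q.toMvPowerSeries) :
    ∃ s, MvPolynomial.constantCoeff s ≠ 0 ∧ p ∣ s * q := by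
  obtain ⟨f, hf⟩ := h
  let I := MvPolynomial.idealOfVars (Fin n) K
  have hmem : ∀ k, ∃ a, q - p * a ∈ I ^ k := by
    intro k
    -- Truncating the quotient series keeps its terms of degree below `k`, so `p * a` agrees with
    -- `q` in those degrees.
    refine ⟨f.truncTotal k, (MvPolynomial.mem_pow_idealOfVars_iff' k _).2 fun x hx => ?_⟩
    have e : MvPowerSeries.coeff x q.toMvPowerSeries = MvPolynomial.coeff x q :=
      MvPolynomial.coeff_coe _ _
    rw [MvPolynomial.coeff_sub, sub_eq_zero, ← e, hf, MvPowerSeries.coeff_mul,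
      MvPolynomial.coeff_mul]
    refine Finset.sum_congr rfl fun y hy => ?_
    have hle : y.2 ≤ x := by
      rw [← Finset.HasAntidiagonal.mem_antidiagonal.1 hy]
      exact le_add_self
    rw [MvPowerSeries.coeff_truncTotal _ ((Finsupp.degree_mono hle).trans_lt hx)]
    rfl
  -- The class of `q` modulo `p` lies in every power of `I` times the quotient. Krull's intersection
  -- theorem then gives `r ∈ I` with `r q ≡ q` modulo `p`.
  have hK : (Ideal.Quotient.mk (Ideal.span {p}) q) ∈
      (⨅ k : ℕ, I ^ k • ⊤ : Submodule (MvPolynomial (Fin n) K)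
        (MvPolynomial (Fin n) K ⧸ Ideal.span {p})) := by
    rw [Submodule.mem_iInf]
    intro k
    obtain ⟨a, ha⟩ := hmem k
    have e : Ideal.Quotient.mk (Ideal.span {p}) q =
        (q - p * a) • (1 : MvPolynomial (Fin n) K ⧸ Ideal.span {p}) := by
      change Ideal.Quotient.mk (Ideal.span {p}) q =
        Ideal.Quotient.mk (Ideal.span {p}) ((q - p * a) * 1)
      rw [mul_one, Ideal.Quotient.eq, sub_sub_cancel]
      exact Ideal.mem_span_singleton.2 (dvd_mul_right p a)
    rw [e]
    exact Submodule.smul_mem_smul ha trivial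
  obtain ⟨r, hr⟩ := (Ideal.mem_iInf_smul_pow_eq_bot_iff I _).1 hK
  refine ⟨1 - r, ?_, ?_⟩
  · rw [map_sub, mem_idealOfVars_iff.1 r.2]
    simp
  · change Ideal.Quotient.mk (Ideal.span {p}) (r * q) = Ideal.Quotient.mk (Ideal.span {p}) q at hr
    rw [eq_comm, Ideal.Quotient.eq, Ideal.mem_span_singleton] at hr
    rwa [sub_mul, one_mul]

theorem exists_prime_dvd_of_constantCoeff_eq_zero {p : MvPolynomial (Fin n) K} (hp : p ≠ 0)
    (h0 : MvPolynomial.constantCoeff p = 0) :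
    ∃ π, Prime π ∧ π ∣ p ∧ MvPolynomial.constantCoeff π = 0 := by
  obtain ⟨f, hf, a, rfl⟩ := UniqueFactorizationMonoid.exists_prime_factors p hp
  have ha : MvPolynomial.constantCoeff (a : MvPolynomial (Fin n) K) ≠ 0 :=
    (a.isUnit.map MvPolynomial.constantCoeff).ne_zero
  rw [map_mul, map_multiset_prod] at h0
  obtain ⟨π, hπ, e⟩ := Multiset.mem_map.1
    (Multiset.prod_eq_zero_iff.1 ((mul_eq_zero.1 h0).resolve_right ha))
  exact ⟨π, hf π hπ, Dvd.dvd.mul_right (Multiset.dvd_prod hπ) _, e⟩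

theorem constantCoeff_ne_zero_of_forall_coe_dvd {P : WeylAlgebra n K} (hP : IsPrimitiveOp P)
    {p : MvPolynomial (Fin n) K} (hp : p ≠ 0)
    (h : ∀ u, p.toMvPowerSeries ∣ (P.coeff u).toMvPowerSeries) :
    MvPolynomial.constantCoeff p ≠ 0 := by
  intro h0
  obtain ⟨π, hπ, hdvd, hπ0⟩ := exists_prime_dvd_of_constantCoeff_eq_zero hp h0
  refine hπ.not_isUnit (hP π fun u => ?_)
  obtain ⟨s, hs, hsu⟩ := exists_dvd_mul_of_coe_dvd (h u)
  -- `π` vanishes at the origin and `s` does not, so `π` divides the other factor.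
  refine (hπ.dvd_or_dvd (hdvd.trans hsu)).resolve_left ?_
  rintro ⟨t, rfl⟩
  exact hs (by rw [map_mul, hπ0, zero_mul])

end Divisibility

/-! ### From an ordinary point to solutions -/

section Main

variable {m : MonomialOrder (Fin n)} {G : Set (WeylAlgebra n K)}

theorem isOrdinaryPoint_zero_iff : IsOrdinaryPoint m G 0 ↔
    ∀ g ∈ G, MvPolynomial.constantCoeff (headCoeff m g) ≠ 0 := by
  refine forall₂_congr fun g _ => not_congr ?_
  rw [MvPolynomial.aeval_zero, map_eq_zero_iff _ (algebraMap K (AlgebraicClosure K)).injective]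

/-- A regular coordinate function on the quotient gives a formal power series solution. -/
theorem isSolution_of_hasValueAtZero [CharZero K]
    (φ : RatOp n K →ₗ[RatFun n K] RatFun n K) (hφ : ∀ P ∈ leftIdeal G, φ P = 0)
    {f : MvPowerSeries (Fin n) K} (hf : ∀ u, HasValueAtZero (φ (DiffOp.single u 1))
      (multiFactorial u * MvPowerSeries.coeff u f)) :
    IsSolution G f := by
  rw [isSolution_iff]
  intro g hg w
  rw [constantCoeff_act]
  apply HasValueAtZero.eq_zero (n := n)
  -- By linearity the sum is the value at the origin of `φ(∂^w g)`, which is zero because `∂^w g`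
  -- lies in the ideal.
  rw [← hφ _ (monomialPow_leftDer_mem_leftIdeal hg w), DiffOp.map_eq_sum φ,
    WeylAlgebra.support_toRatOp]
  refine HasValueAtZero.sum _ fun u _ => ?_
  rw [WeylAlgebra.coeff_toRatOp]
  exact (hasValueAtZero_algebraMap _).mul (hf u)

/-- The series has Taylor coefficients `φ_v(∂^u)(0) / u!`, where `φ_v` is the coordinate at `∂^v`.
The vanishing at the other parametric exponents serves to prove linear independence. -/
theorem exists_solution_of_isOrdinaryPoint [CharZero K] (hG : IsPrimitiveGroebnerBasis m G)
    (h : IsOrdinaryPoint m G 0) (v : parametricExponents m G) :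
    ∃ f : MvPowerSeries (Fin n) K, IsSolution G f ∧ IsInitialExponent m f v ∧
      ∀ w : parametricExponents m G, w ≠ v → MvPowerSeries.coeff w.1 f = 0 := by
  classical
  have hmem : ∀ P ∈ leftIdeal G, parametricCoord hG v P = 0 :=
    fun P hP => parametricCoord_of_mem hG v hP
  have hval (w : parametricExponents m G) : HasValueAtZero
      (parametricCoord hG v (DiffOp.single w.1 1)) (if w = v then 1 else 0) := by
    have h := hasValueAtZero_algebraMap (n := n) (K := K) (if w = v then 1 else 0)
    rw [apply_ite (algebraMap _ _), apply_ite MvPolynomial.constantCoeff, map_one, map_one,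
      map_zero, map_zero] at h
    rwa [parametricCoord_single]
  choose c hc using exists_hasValueAtZero (isOrdinaryPoint_zero_iff.1 h) _ hmem
    fun w hw => ⟨_, hval ⟨w, hw⟩⟩
  obtain ⟨f, hf⟩ : ∃ f : MvPowerSeries (Fin n) K,
      ∀ u, MvPowerSeries.coeff u f = c u / multiFactorial u := ⟨fun u => _, fun u => rfl⟩
  have hfac (u : Fin n →₀ ℕ) : (multiFactorial u : K) ≠ 0 :=
    Nat.cast_ne_zero.2 (multiFactorial_ne_zero u)
  refine ⟨f, isSolution_of_hasValueAtZero _ hmem fun u => ?_, ⟨?_, fun u hu => ?_⟩,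
    fun w hw => ?_⟩
  · rw [hf, mul_div_cancel₀ _ (hfac u)]
    exact hc u
  · rw [hf, (hc v).unique (hval v), if_pos rfl]
    exact div_ne_zero one_ne_zero (hfac _)
  · have h := hc u
    rw [parametricCoord_single_of_lt hG v hu] at h
    rw [hf, h.eq_zero, zero_div]
  · rw [hf, (hc w).unique (hval w), if_neg hw, zero_div]

theorem IsInitialExponent.unique {f : MvPowerSeries (Fin n) K} {u v : Fin n →₀ ℕ}
    (hu : IsInitialExponent m f u) (hv : IsInitialExponent m f v) : u = v := by
  rcases lt_trichotomy (m.toSyn u) (m.toSyn v) with h | h | h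
  · exact absurd (hv.2 u h) hu.1
  · exact m.toSyn.injective h
  · exact absurd (hu.2 v h) hv.1

theorem exists_fundamental_system_of_isOrdinaryPoint [CharZero K]
    (hG : IsPrimitiveGroebnerBasis m G) (hr : HasFiniteRank G) (h : IsOrdinaryPoint m G 0) :
    ∃ f : Fin (rank G) → MvPowerSeries (Fin n) K, LinearIndependent K f ∧
      (∀ j, IsSolution G (f j)) ∧
      {u | ∃ j, IsInitialExponent m (f j) u} = parametricExponents m G := by
  have := finite_parametricExponents hG hr
  choose f hsol hinit hcoeff using exists_solution_of_isOrdinaryPoint hG h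
  let e : Fin (rank G) ≃ parametricExponents m G :=
    (finCongr (rank_eq_card hG)).trans (Finite.equivFin _).symm
  refine ⟨fun j => f (e j), LinearIndependent.comp ?_ e e.injective, fun j => hsol _, ?_⟩
  · rw [linearIndependent_iff']
    intro s a ha v hv
    have h := congrArg (MvPowerSeries.coeff v.1) ha
    rw [map_sum, Finset.sum_eq_single_of_mem v hv, MvPowerSeries.coeff_smul, map_zero] at h
    · exact (mul_eq_zero.1 h).resolve_right (hinit v).1
    · intro w _ hw
      rw [MvPowerSeries.coeff_smul, hcoeff w v hw.symm, mul_zero]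
  · ext u
    constructor
    · rintro ⟨j, hj⟩
      rw [hj.unique (hinit (e j))]
      exact (e j).2
    · intro hu
      refine ⟨e.symm ⟨u, hu⟩, ?_⟩
      change IsInitialExponent m (f (e (e.symm ⟨u, hu⟩))) u
      rw [e.apply_symm_apply]
      exact hinit ⟨u, hu⟩

/-! ### From solutions to an ordinary point -/

theorem det_ne_zero_of_injective {ι α R : Type*} [Fintype ι] [DecidableEq ι] [LinearOrder α]
    [CommRing R] [IsDomain R] (b : ι → α) (hb : Function.Injective b) {M : Matrix ι ι R}
    (hM : ∀ i j, b i < b j → M i j = 0) (hd : ∀ i, M i i ≠ 0) : M.det ≠ 0 := by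
  -- Ordering the indices through `b` makes `M` lower triangular.
  let _ : LinearOrder ι := LinearOrder.lift' b hb
  rw [Matrix.det_of_isLowerTriangular M fun i j h => hM i j h]
  exact Finset.prod_ne_zero_iff.2 fun i _ => hd i

/-- The generalized Wronskian matrix of series with pairwise different initial exponents is
invertible over the power series ring. -/
theorem isUnit_wronskian [CharZero K] {S : Set (Fin n →₀ ℕ)} [Fintype S] [DecidableEq S]
    {f : S → MvPowerSeries (Fin n) K} (hf : ∀ v, IsInitialExponent m (f v) v) :
    IsUnit (Matrix.of fun v w : S => monomialPow (fun i => (MvPowerSeries.pderiv K i :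
      Module.End K (MvPowerSeries (Fin n) K))) v.1 (f w)).det := by
  -- It suffices to evaluate at the origin, where the `(v, w)` entry is `v!` times the coefficient
  -- of `x^v` in `f w`, which is zero for `v ≺ w`.
  rw [MvPowerSeries.isUnit_iff_constantCoeff, RingHom.map_det, isUnit_iff_ne_zero]
  have key : ∀ v w : S, (MvPowerSeries.constantCoeff.mapMatrix (Matrix.of fun v w : S =>
      monomialPow (fun i => (MvPowerSeries.pderiv K i :
        Module.End K (MvPowerSeries (Fin n) K))) v.1 (f w))) v w =
      multiFactorial v.1 * MvPowerSeries.coeff v.1 (f w) :=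
    fun v w => constantCoeff_monomialPow_pderiv _ _
  refine det_ne_zero_of_injective (fun v : S => m.toSyn v.1)
    (m.toSyn.injective.comp Subtype.val_injective) (fun v w h => ?_) fun v => ?_
  · rw [key, (hf w).2 _ h, mul_zero]
  · rw [key]
    exact mul_ne_zero (Nat.cast_ne_zero.2 (multiFactorial_ne_zero _)) (hf v).1

/-- Reducedness excludes the head terms of the other elements. The head term of `g` itself cannot
divide a strictly lower term of `g`. -/
theorem IsPrimitiveGroebnerBasis.mem_parametricExponents (hG : IsPrimitiveGroebnerBasis m G)
    {g : WeylAlgebra n K} (hg : g ∈ G) {u : Fin n →₀ ℕ} (hu : g.coeff u ≠ 0)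
    (hne : u ≠ headExp m g) : u ∈ parametricExponents m G := by
  intro h hh hle
  by_cases e : h.toRatOp = g.toRatOp
  · rw [e, WeylAlgebra.headExp_toRatOp] at hle
    exact hne (m.toSyn.injective (le_antisymm (le_headExp hu) (m.toSyn_monotone hle)))
  · refine hG.reduced _ ⟨g, hg, rfl⟩ _ ⟨h, hh, rfl⟩ e u ?_ hle
    rw [WeylAlgebra.support_toRatOp]
    exact DiffOp.mem_support.2 hu

theorem headExp_notMem_parametricExponents {g : WeylAlgebra n K} (hg : g ∈ G) :
    headExp m g ∉ parametricExponents m G :=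
  fun h => h g hg (WeylAlgebra.headExp_toRatOp m g).le

/-- The equations `g(f w) = 0` form a square linear system for the non-head coefficients of `g`,
with invertible matrix and right-hand side a multiple of the head coefficient. -/
theorem isOrdinaryPoint_of_solutions [CharZero K] (hG : IsPrimitiveGroebnerBasis m G)
    (hr : HasFiniteRank G) {f : parametricExponents m G → MvPowerSeries (Fin n) K}
    (hsol : ∀ v, IsSolution G (f v)) (hinit : ∀ v, IsInitialExponent m (f v) v) :
    IsOrdinaryPoint m G 0 := by
  classical
  have := finite_parametricExponents hG hr
  let _ := Fintype.ofFinite (parametricExponents m G)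
  rw [isOrdinaryPoint_zero_iff]
  intro g hg
  refine constantCoeff_ne_zero_of_forall_coe_dvd (hG.primitive g hg)
    (headCoeff_ne_zero (hG.ne_zero hg)) ?_
  set D := monomialPow (fun i : Fin n => (MvPowerSeries.pderiv K i :
    Module.End K (MvPowerSeries (Fin n) K))) with hD
  let E := Matrix.of fun v w : parametricExponents m G => D v.1 (f w)
  let y : parametricExponents m G → MvPowerSeries (Fin n) K :=
    fun v => (g.coeff v.1).toMvPowerSeries
  let z : parametricExponents m G → MvPowerSeries (Fin n) K := fun w => - D (headExp m g) (f w)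
  have hE : IsUnit E.det := isUnit_wronskian hinit
  have hyz : Matrix.vecMul y E = (headCoeff m g).toMvPowerSeries • z := by
    funext w
    have h := hsol w g hg
    unfold WeylAlgebra.act at h
    rw [← Finset.add_sum_erase _ _
      (DiffOp.mem_support.2 (headCoeff_ne_zero (hG.ne_zero hg)) : headExp m g ∈ g.support)] at h
    have hsum : ∑ v ∈ g.support.erase (headExp m g), (g.coeff v).toMvPowerSeries * D v (f w) =
        ∑ v : parametricExponents m G, (g.coeff v.1).toMvPowerSeries * D v.1 (f w) := by
      rw [← Finset.sum_subtype (parametricExponents m G).toFinset (fun x => Set.mem_toFinset)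
        (fun v => (g.coeff v).toMvPowerSeries * D v (f w))]
      -- The non-head exponents of `g` are parametric. A parametric exponent is never the head
      -- exponent, so the additional summands have coefficient zero.
      refine Finset.sum_subset (fun v hv => ?_) fun v hv hv' => ?_
      · rw [Finset.mem_erase, DiffOp.mem_support] at hv
        exact Set.mem_toFinset.2 (hG.mem_parametricExponents hg hv.2 hv.1)
      · rw [Finset.mem_erase, not_and, DiffOp.mem_support, not_not] at hv'
        rw [hv' fun e => headExp_notMem_parametricExponents hg (e ▸ Set.mem_toFinset.1 hv)]
        exact zero_mul _
    rw [hsum] at h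
    change ∑ v, y v * E v w = _ * - _
    rw [mul_neg]
    exact eq_neg_of_add_eq_zero_right h
  -- Inverting the matrix exhibits each entry of `y` as the head coefficient times a power series.
  have hy : y = (headCoeff m g).toMvPowerSeries • Matrix.vecMul z E⁻¹ := by
    rw [← Matrix.smul_vecMul, ← hyz, Matrix.vecMul_vecMul, Matrix.mul_nonsing_inv _ hE,
      Matrix.vecMul_one]
  intro u
  by_cases hu : g.coeff u = 0
  · rw [hu]
    exact dvd_zero _
  by_cases he : u = headExp m g
  · rw [he]
    exact dvd_rfl
  · exact ⟨_, congrFun hy ⟨u, hG.mem_parametricExponents hg hu he⟩⟩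

end Main

end DFinite

theorem mainTheorem1 {K : Type*} [Field K] [CharZero K] {n : ℕ} (hn : 0 < n)
    (m : MonomialOrder (Fin n)) (hm : DFinite.IsGraded m)
    (G : Set (DFinite.WeylAlgebra n K)) (hG : DFinite.IsPrimitiveGroebnerBasis m G)
    (hrank : DFinite.HasFiniteRank G) :
    DFinite.IsOrdinaryPoint m G 0 ↔
      ∃ f : Fin (DFinite.rank G) → MvPowerSeries (Fin n) K,
        LinearIndependent K f ∧
        (∀ j, DFinite.IsSolution G (f j)) ∧
        {u | ∃ j, DFinite.IsInitialExponent m (f j) u} = DFinite.parametricExponents m G := by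
  refine ⟨DFinite.exists_fundamental_system_of_isOrdinaryPoint hG hrank, ?_⟩
  rintro ⟨f, -, hsol, hPE⟩
  have h : ∀ v : DFinite.parametricExponents m G, ∃ j, DFinite.IsInitialExponent m (f j) v :=
    fun v => hPE.ge v.2
  choose j hj using h
  exact DFinite.isOrdinaryPoint_of_solutions hG hrank (fun v => hsol (j v)) hj
end
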